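/- **Definitions.** Let $G$ be a finite graph and $r$ a vertex of $G$ (the root). A *configuration* is a function $C:V(G)\to\mathbb N$, of size $\sum_v C(v)$. A *pebbling step* from a vertex $u$ with $C(u)\ge 2$ to a neighbour $v$ of $u$ removes two pebbles from $u$ and adds one pebble to $v$. The configuration $C$ is *$r$-solvable* if some finite (possibly empty) sequence of pebbling steps starting from $C$ leads to a configuration with at least one pebble on $r$. The rooted pebbling number $\pi(G,r)$ is the minimum $t$ such that every configuration of size $t$ is $r$-solvable. An *$r$-strategy* is a subtree $T$ of $G$ with at least two vertices that contains $r$ and is rooted at $r$, together with a nonnegative, nonzero weight function $w:V(G)\to\mathbb R$ such that $w(r)=0$, $w(v)=0$ for $v\notin V(T)$, and $w(v^+)=2w(v)$ for every vertex $v\ne r$ of $T$ that is not a child of $r$, where $v^+$ is the parent of $v$ in $T$ (the neighbour of $v$ in $T$ that is one step closer to $r$). Write $w(C)=\sum_v w(v)C(v)$, and let $\mathbf T$ be the configuration with $\mathbf T(v)=1$ for $v\in V(T)\setminus\{r\}$ and $\mathbf T(v)=0$ otherwise. Let $z_{G,r}$ be the optimal value of the integer linear program $$\text{maximize } \sum_{v\ne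 r}C(v)\quad\text{over configurations } C:V(G)\to\mathbb N \text{ with } w(C)\le w(\mathbf T)\text{ for every } r\text{-strategy }(T,w)$$ (with $z_{G,r}=\infty$ if it is unbounded). Let $Q^d$ be the $d$-cube, the graph on the binary vectors of length $d$ in which two vectors are adjacent when they differ in exactly one coordinate. **Theorem.** For every $d\ge 1$ and every vertex $r$ of $Q^d$, $$z_{Q^d,r}<2\,\pi(Q^d,r).$$ -/

import Mathlib

namespace Pebbling

/-- A configuration assigns to every vertex its number of pebbles. -/
abbrev Config (V : Type*) := V → ℕ

section

variable {V : Type*} [Fintype V] [DecidableEq V]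

/-- A pebbling step from `u` to a neighbour `v`: two pebbles are removed from `u` and one pebble
is added to `v`. -/
def Step (G : SimpleGraph V) (C D : Config V) : Prop :=
  ∃ u v, G.Adj u v ∧ 2 ≤ C u ∧
    D = fun x => if x = u then C u - 2 else if x = v then C v + 1 else C x

/-- `C` is `r`-solvable: some finite (possibly empty) sequence of pebbling steps starting at `C`
puts a pebble on `r`. -/
def Solvable (G : SimpleGraph V) (r : V) (C : Config V) : Prop :=
  ∃ D, Relation.ReflTransGen (Step G) C D ∧ 1 ≤ D r

/-- The rooted pebbling number `π(G, r)`: the minimum `t` such that every configuration of size `t`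
is `r`-solvable. -/
noncomputable def pebblingNumber (G : SimpleGraph V) (r : V) : ℕ :=
  sInf {t : ℕ | ∀ C : Config V, ∑ v, C v = t → Solvable G r C}

/-- In the tree `T` rooted at `r`, the vertex `u` is the parent of `v`: it is the `T`-neighbour of
`v` that is one step closer to `r` in `T`. -/
def IsParent {G : SimpleGraph V} (T : G.Subgraph) (r u v : V) : Prop :=
  T.Adj u v ∧ T.spanningCoe.dist r v = T.spanningCoe.dist r u + 1

/-- An `r`-strategy of `G`: a subtree of `G` that contains `r` and has at least two vertices,
with a nonnegative, nonzero weight function that vanishes at `r` and off the tree, and whose value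
at the parent of a vertex is twice the value at that vertex, unless that parent is the root. -/
structure Strategy (G : SimpleGraph V) (r : V) where
  tree : G.Subgraph
  isTree : tree.coe.IsTree
  root_mem : r ∈ tree.verts
  nontrivial : tree.verts.Nontrivial
  weight : V → ℝ
  weight_nonneg : ∀ v, 0 ≤ weight v
  weight_ne_zero : weight ≠ 0
  weight_root : weight r = 0
  weight_off : ∀ v, v ∉ tree.verts → weight v = 0
  weight_parent : ∀ u v, u ≠ r → IsParent tree r u v → weight u = 2 * weight v

/-- The weight `w(C)` of a configuration. -/
def Strategy.weightOf {G : SimpleGraph V} {r : V} (S : Strategy G r) (C : Config V) : ℝ :=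
  ∑ v, S.weight v * (C v : ℝ)

open scoped Classical in
/-- The configuration with one pebble on every vertex of the tree other than the root. -/
noncomputable def Strategy.treeConfig {G : SimpleGraph V} {r : V} (S : Strategy G r) : Config V :=
  fun v => if v ∈ S.tree.verts ∧ v ≠ r then 1 else 0

/-- The feasible points of the integer program: the configurations that satisfy the weight
inequality of every `r`-strategy. -/
def Feasible (G : SimpleGraph V) (r : V) (C : Config V) : Prop :=
  ∀ S : Strategy G r, S.weightOf C ≤ S.weightOf S.treeConfig

/-- The optimal value `z_{G,r}` of the integer program: the supremum of `∑_{v ≠ r} C(v)` over the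
feasible configurations, infinite when the program is unbounded. -/
noncomputable def strategyBound (G : SimpleGraph V) (r : V) : ℕ∞ :=
  ⨆ C : {C : Config V // Feasible G r C}, ((∑ v ∈ Finset.univ.erase r, C.1 v : ℕ) : ℕ∞)

end

/-- The `d`-cube: binary vectors of length `d`, adjacent when they differ in exactly one
coordinate. -/
def cube (d : ℕ) : SimpleGraph (Fin d → Bool) where
  Adj u v := hammingDist u v = 1
  symm := ⟨fun u v h => by rw [hammingDist_comm]; exact h⟩
  loopless := ⟨fun u h => by simp at h⟩

end Pebbling

/-! Identify a vertex of the cube with the set `A` of coordinates in which it agrees with `r`, so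
that `r` is the full set. A family of proper subsets in which every member can be enlarged by one
element to another member or to the full set spans a tree rooted at `r`. Weights `2⁻ˡ`, with `l` the
distance to `r`, are proportional to `2 ^ #A` and make this tree a strategy.

Suppose the family has `𝒜 k` as its level of `k`-sets, for `k < d`. Averaging its inequality over
all permutations of the coordinates gives every vertex of level `k` the coefficient `2 ^ k * #(𝒜 k)
/ d.choose k`. If each level has density at least `2⁻ᵏ`, these coefficients are at least 1, and the
size of a feasible configuration off the root is at most `∑ 2 ^ k * #(𝒜 k)`. With sizes rounded up
to the next integer this sum is less than `∑ (d.choose k + 2 ^ k) = 2 * (2 ^ d - 1)`, while `π ≥ 2 ^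
d`.

The families come from Kruskal–Katona in Lovász's form (`IsColexInitial.choose_le_card_shadow`,
`exists_families`): the shadow of a colex initial segment of density at least `2⁻⁽ᵏ⁺¹⁾` has density
at least `2⁻ᵏ`, so levels are chosen from the top down, each inside the shadow of the one above.
`Feasible.sum_lt` does the averaging. -/

namespace Pebbling

/-! ### Shadows of colex initial segments and the choice of the levels. -/

section Shadow

open Finset Finset.Colex
open scoped FinsetFamily

/-- The binomial coefficient `x(x-1)⋯(x-k+1)/k!` with a real upper argument. -/
noncomputable def realChoose (x : ℝ) : ℕ → ℝ
  | 0 => 1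
  | k + 1 => realChoose x k * (x - k) / (k + 1)

theorem realChoose_pascal (x : ℝ) (k : ℕ) :
    realChoose x (k + 1) = realChoose (x - 1) k + realChoose (x - 1) (k + 1) := by
  induction k with
  | zero => simp [realChoose]
  | succ k ih =>
    rw [realChoose, ih]
    simp only [realChoose]
    have h1 : (k : ℝ) + 1 ≠ 0 := by positivity
    have h2 : (k : ℝ) + 1 + 1 ≠ 0 := by positivity
    push_cast
    field_simp
    ring

theorem realChoose_nonneg {x : ℝ} {k : ℕ} (h : (k : ℝ) ≤ x + 1) : 0 ≤ realChoose x k := by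
  induction k with
  | zero => simp [realChoose]
  | succ k ih =>
    push_cast at h
    have := ih (by linarith)
    rw [realChoose]
    have : 0 ≤ x - k := by linarith
    positivity

theorem realChoose_pos {x : ℝ} {k : ℕ} (h : (k : ℝ) < x + 1) : 0 < realChoose x k := by
  induction k with
  | zero => simp [realChoose]
  | succ k ih =>
    push_cast at h
    have := ih (by linarith)
    rw [realChoose]
    have : 0 < x - k := by linarith
    positivity

theorem realChoose_mono {x y : ℝ} {k : ℕ} (h : (k : ℝ) ≤ x + 1) (hxy : x ≤ y) :
    realChoose x k ≤ realChoose y k := by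
  induction k with
  | zero => simp [realChoose]
  | succ k ih =>
    push_cast at h
    have := ih (by linarith)
    rw [realChoose, realChoose]
    have h0 : 0 ≤ x - k := by linarith
    have := realChoose_nonneg (x := y) (k := k) (by linarith)
    gcongr

theorem realChoose_natCast (n k : ℕ) : realChoose n k = n.choose k := by
  induction k with
  | zero => simp [realChoose]
  | succ k ih =>
    rw [realChoose, ih, div_eq_iff (by positivity)]
    rcases le_or_gt k n with h | h
    · rw [← Nat.cast_sub h]
      exact_mod_cast (Nat.choose_succ_right_eq n k).symm
    · simp [Nat.choose_eq_zero_of_lt h, Nat.choose_eq_zero_of_lt (h.trans (Nat.lt_succ_self k))]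

theorem continuous_realChoose (k : ℕ) : Continuous fun x => realChoose x k := by
  induction k with
  | zero => simpa [realChoose] using continuous_const
  | succ k ih =>
    simp only [realChoose]
    fun_prop

variable {α : Type*} [LinearOrder α]

/-- `𝒜` is an initial segment, in the colexicographic order, of the `k`-subsets of `s`. -/
def IsColexInitial (s : Finset α) (𝒜 : Finset (Finset α)) (k : ℕ) : Prop :=
  (∀ A ∈ 𝒜, A ⊆ s ∧ #A = k) ∧
    ∀ A ∈ 𝒜, ∀ B ⊆ s, #B = k → toColex B < toColex A → B ∈ 𝒜

theorem toColex_insert_lt_insert {a : α} {A B : Finset α} (hA : a ∉ A) (hB : a ∉ B) :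
    toColex (insert a A) < toColex (insert a B) ↔ toColex A < toColex B := by
  rw [← toColex_sdiff_lt_toColex_sdiff (u := {a}) (by simp) (by simp)]
  simp [sdiff_singleton_eq_erase, hA, hB]

section

variable {a : α} {s : Finset α} {𝒜 : Finset (Finset α)} {k : ℕ}

theorem IsColexInitial.nonMemberSubfamily (h : IsColexInitial (insert a s) 𝒜 k) (ha : a ∉ s) :
    IsColexInitial s (𝒜.nonMemberSubfamily a) k := by
  refine ⟨fun A hA => ?_, fun A hA B hB hk hlt => ?_⟩
  · rw [mem_nonMemberSubfamily] at hA
    exact ⟨(subset_insert_iff_of_notMem hA.2).1 (h.1 A hA.1).1, (h.1 A hA.1).2⟩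
  · rw [mem_nonMemberSubfamily] at hA ⊢
    exact ⟨h.2 A hA.1 B (hB.trans (subset_insert _ _)) hk hlt, fun h' => ha (hB h')⟩

theorem IsColexInitial.memberSubfamily (h : IsColexInitial (insert a s) 𝒜 (k + 1)) (ha : a ∉ s) :
    IsColexInitial s (𝒜.memberSubfamily a) k := by
  refine ⟨fun A hA => ?_, fun A hA B hB hk hlt => ?_⟩
  · rw [mem_memberSubfamily] at hA
    have := h.1 _ hA.1
    rw [card_insert_of_notMem hA.2] at this
    exact ⟨(subset_insert_iff_of_notMem hA.2).1 ((subset_insert _ _).trans this.1), by omega⟩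
  · rw [mem_memberSubfamily] at hA ⊢
    have haB : a ∉ B := fun h' => ha (hB h')
    refine ⟨h.2 _ hA.1 _ (insert_subset_insert _ hB) ?_ ?_, haB⟩
    · rw [card_insert_of_notMem haB, hk]
    · rwa [toColex_insert_lt_insert haB hA.2]

/-- Exchanging an element of a set for the smaller element `a` yields a colex-smaller set of the
same size, which an initial segment must contain. -/
theorem IsColexInitial.shadow_nonMemberSubfamily_subset (h : IsColexInitial (insert a s) 𝒜 k)
    (ha : ∀ x ∈ s, a < x) : ∂ (𝒜.nonMemberSubfamily a) ⊆ 𝒜.memberSubfamily a := by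
  intro B hB
  obtain ⟨A, hA, b, hb, rfl⟩ := mem_shadow_iff.1 hB
  rw [mem_nonMemberSubfamily] at hA
  have hab : a ∉ A.erase b := fun h' => hA.2 (mem_of_mem_erase h')
  have hAs : A ⊆ s := (subset_insert_iff_of_notMem hA.2).1 (h.1 A hA.1).1
  rw [mem_memberSubfamily]
  refine ⟨h.2 A hA.1 _ (insert_subset_insert _ ((erase_subset _ _).trans hAs)) ?_ ?_, hab⟩
  · rw [card_insert_of_notMem hab, card_erase_add_one hb, (h.1 A hA.1).2]
  · conv_rhs => rw [← insert_erase hb]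
    exact (insert_lt_insert hab (notMem_erase b A)).2 (ha b (hAs hb))

/-- Split the shadow by membership of `a`: removing `a` produces the link of `a`, and removing
another element produces `a` joined to the shadow of the link. -/
theorem card_memberSubfamily_add_card_shadow_le (a : α) (𝒜 : Finset (Finset α)) :
    #(𝒜.memberSubfamily a) + #(∂ (𝒜.memberSubfamily a)) ≤ #(∂ 𝒜) := by
  rw [← card_memberSubfamily_add_card_nonMemberSubfamily a (∂ 𝒜), add_comm]
  refine add_le_add (card_le_card fun B hB => ?_) (card_le_card fun B hB => ?_)
  · obtain ⟨A, hA, b, hb, rfl⟩ := mem_shadow_iff.1 hB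
    rw [mem_memberSubfamily] at hA
    have hab : a ≠ b := fun h => hA.2 (h ▸ hb)
    rw [mem_memberSubfamily, ← erase_insert_of_ne hab]
    exact ⟨erase_mem_shadow hA.1 (mem_insert_of_mem hb),
      fun h => hA.2 (mem_of_mem_erase h)⟩
  · rw [mem_memberSubfamily] at hB
    rw [mem_nonMemberSubfamily]
    refine ⟨?_, hB.2⟩
    have := erase_mem_shadow hB.1 (mem_insert_self a B)
    rwa [erase_insert hB.2] at this

end

theorem natCast_le_card_shadow_of_nonempty {𝒜 : Finset (Finset α)} {A : Finset α} (hA : A ∈ 𝒜) :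
    #A ≤ #(∂ 𝒜) := by
  refine card_le_card_of_injOn (fun b => A.erase b) (fun b hb => erase_mem_shadow hA hb) ?_
  exact A.erase_injOn

/-- Lovász's form of the Kruskal–Katona theorem, for initial segments of the colexicographic
order. -/
theorem IsColexInitial.realChoose_le_card_shadow (s : Finset α) :
    ∀ (𝒜 : Finset (Finset α)) (k : ℕ) (x : ℝ), IsColexInitial s 𝒜 (k + 1) → (k : ℝ) + 1 ≤ x →
      realChoose x (k + 1) ≤ #𝒜 → realChoose x k ≤ #(∂ 𝒜) := by
  induction s using Finset.induction_on_min with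
  | empty =>
    intro 𝒜 k x h hx hc
    have h𝒜 : 𝒜 = ∅ := by
      rw [eq_empty_iff_forall_notMem]
      intro A hA
      have := h.1 A hA
      rw [subset_empty] at this
      simp [this.1] at this
    have := realChoose_pos (x := x) (k := k + 1) (by push_cast; linarith)
    simp [h𝒜] at hc
    linarith
  | insert a s ha ih =>
    intro 𝒜 k x h hx hc
    have has : a ∉ s := fun h' => lt_irrefl _ (ha a h')
    have hpos := realChoose_pos (x := x) (k := k + 1) (by push_cast; linarith)
    have hne : 𝒜.Nonempty := by
      rw [← card_pos]
      exact_mod_cast hpos.trans_le hc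
    obtain ⟨A, hA⟩ := hne
    cases k with
    | zero =>
      have h1 := natCast_le_card_shadow_of_nonempty hA
      rw [(h.1 A hA).2] at h1
      simp only [realChoose]
      exact_mod_cast h1
    | succ k =>
      have hsum := card_memberSubfamily_add_card_nonMemberSubfamily a 𝒜
      have hsum' : (#(𝒜.memberSubfamily a) : ℝ) + #(𝒜.nonMemberSubfamily a) = #𝒜 := by
        exact_mod_cast hsum
      have hmem : realChoose (x - 1) (k + 1) ≤ #(𝒜.memberSubfamily a) := by
        -- If the link of `a` were too small, Pascal's rule would make the sets avoiding `a`
        -- numerous; by induction their shadow would be large, yet it lies in the link.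
        by_contra! hlt
        have hnon : realChoose (x - 1) (k + 2) < #(𝒜.nonMemberSubfamily a) := by
          have := realChoose_pascal x (k + 1)
          linarith
        have hcard : (#(∂ (𝒜.nonMemberSubfamily a)) : ℝ) ≤ #(𝒜.memberSubfamily a) := by
          exact_mod_cast card_le_card (h.shadow_nonMemberSubfamily_subset ha)
        push_cast at hx
        rcases le_or_gt ((k : ℝ) + 2) (x - 1) with hx1 | hx1
        · have := ih _ (k + 1) (x - 1) (h.nonMemberSubfamily has) (by push_cast; linarith) hnon.le
          linarith
        -- Here `x - 1` is too small for the induction hypothesis. One set avoiding `a` exists, so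
        -- `k + 2`, whose binomial coefficient is 1, serves instead.
        · have h0 : 0 ≤ realChoose (x - 1) (k + 2) := realChoose_nonneg (by push_cast; linarith)
          have h1 : (1 : ℝ) ≤ #(𝒜.nonMemberSubfamily a) := by
            exact_mod_cast h0.trans_lt hnon
          have h2 := ih _ (k + 1) ((k + 2 : ℕ) : ℝ) (h.nonMemberSubfamily has)
            (by push_cast; linarith) (by rw [realChoose_natCast]; simpa using h1)
          have h3 := realChoose_mono (x := x - 1) (y := ((k + 2 : ℕ) : ℝ)) (k := k + 1)
            (by push_cast; linarith) (by push_cast; linarith)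
          linarith
      have := ih _ k (x - 1) (h.memberSubfamily has) (by push_cast at hx; linarith) hmem
      have hle : (#(𝒜.memberSubfamily a) : ℝ) + #(∂ (𝒜.memberSubfamily a)) ≤ #(∂ 𝒜) := by
        exact_mod_cast card_memberSubfamily_add_card_shadow_le a 𝒜
      rw [realChoose_pascal]
      linarith

/-- If a nonempty initial segment has density at least `2⁻ᵏ` among the `k`-subsets of an `n`-set,
then its shadow has density at least `2⁻⁽ᵏ⁻¹⁾` among the `(k-1)`-subsets. -/
theorem IsColexInitial.choose_le_card_shadow {n k : ℕ} {s : Finset α} {𝒜 : Finset (Finset α)}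
    (h : IsColexInitial s 𝒜 (k + 1)) (hne : 𝒜.Nonempty) (hk : k + 2 ≤ n)
    (hc : n.choose (k + 1) ≤ 2 ^ (k + 1) * #𝒜) : n.choose k ≤ 2 ^ k * #(∂ 𝒜) := by
  have hkn : (k : ℝ) + 2 ≤ n := by exact_mod_cast hk
  have hchoose : (n.choose (k + 1) : ℝ) * (k + 1) = n.choose k * (n - k) := by
    rw [← Nat.cast_sub (by omega)]
    exact_mod_cast Nat.choose_succ_right_eq n k
  have hc' : (n.choose (k + 1) : ℝ) / 2 ^ (k + 1) ≤ #𝒜 := by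
    rw [div_le_iff₀ (by positivity), mul_comm]
    exact_mod_cast hc
  have h1 : (1 : ℝ) ≤ #𝒜 := by exact_mod_cast hne.card_pos
  suffices hx : ∃ x : ℝ, (k : ℝ) + 1 ≤ x ∧ realChoose x (k + 1) ≤ #𝒜 ∧
      (n.choose k : ℝ) / 2 ^ k ≤ realChoose x k by
    obtain ⟨x, hx1, hx2, hx3⟩ := hx
    have := hx3.trans (IsColexInitial.realChoose_le_card_shadow s 𝒜 k x h hx1 hx2)
    rw [div_le_iff₀ (by positivity), mul_comm] at this
    exact_mod_cast this
  rcases le_or_gt ((n.choose (k + 1) : ℝ) / 2 ^ (k + 1)) 1 with ha | ha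
  -- The target is at most one set, so `x = k + 1` suffices; `n - k ≥ 2` absorbs the lost factor 2.
  · refine ⟨(k + 1 : ℕ), by push_cast; exact le_rfl, ?_, ?_⟩
    · rw [realChoose_natCast]; simpa using h1
    · rw [realChoose_natCast, Nat.choose_succ_self_right, div_le_iff₀ (by positivity)]
      rw [div_le_iff₀ (by positivity), pow_succ] at ha
      push_cast
      have : (n.choose k : ℝ) * 2 ≤ n.choose k * (n - k) := by gcongr; linarith
      nlinarith
  -- Factor by factor, `(n - j) / 2 ≤ (n + k) / 2 - j` for `j ≤ k`. Hence the solution `x` of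
  -- `realChoose x (k + 1) = n.choose (k + 1) / 2 ^ (k + 1)` can be taken with `x - k ≤ (n - k) /
  -- 2`, which is what passing from `k + 1` to `k` needs.
  · have htop : (n.choose (k + 1) : ℝ) / 2 ^ (k + 1) ≤ realChoose ((n + k : ℝ) / 2) (k + 1) := by
      have key : ∀ j ≤ k + 1, realChoose n j / 2 ^ j ≤ realChoose ((n + k : ℝ) / 2) j := by
        intro j
        induction j with
        | zero => simp [realChoose]
        | succ j ih =>
          intro hj
          have hj' : (j : ℝ) ≤ k := by exact_mod_cast (by omega : j ≤ k)
          have e : realChoose n (j + 1) / 2 ^ (j + 1)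
              = realChoose n j / 2 ^ j * ((n - j) / 2) / (j + 1) := by
            rw [realChoose, pow_succ]; field_simp
          rw [e, realChoose]
          have h0 : 0 ≤ realChoose ((n + k : ℝ) / 2) j := realChoose_nonneg (by linarith)
          have h2 : (0 : ℝ) ≤ (n - j) / 2 := by linarith
          have h3 : ((n : ℝ) - j) / 2 ≤ (n + k) / 2 - j := by linarith
          have := ih (by omega)
          gcongr
      simpa [realChoose_natCast] using key (k + 1) le_rfl
    have hbot : realChoose ((k + 1 : ℕ) : ℝ) (k + 1) ≤ (n.choose (k + 1) : ℝ) / 2 ^ (k + 1) := by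
      rw [realChoose_natCast]; simpa using ha.le
    obtain ⟨x, ⟨hx1, hx2⟩, hx⟩ := intermediate_value_Icc
      (f := fun x => realChoose x (k + 1)) (a := ((k + 1 : ℕ) : ℝ)) (b := (n + k : ℝ) / 2)
      (by push_cast; linarith) (continuous_realChoose _).continuousOn ⟨hbot, htop⟩
    push_cast at hx1
    refine ⟨x, hx1, hx.trans_le hc', ?_⟩
    simp only [realChoose] at hx
    have hpos := realChoose_nonneg (x := x) (k := k) (by linarith)
    rw [div_eq_div_iff (by positivity) (by positivity)] at hx
    rw [div_le_iff₀ (by positivity)]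
    have hxk : 0 < (n : ℝ) - k := by linarith
    have hle : realChoose x k * (x - k) ≤ realChoose x k * ((n - k) / 2) := by
      gcongr; linarith
    rw [hchoose, pow_succ] at hx
    have : (n.choose k : ℝ) * (n - k) ≤ realChoose x k * 2 ^ k * (n - k) := by
      have h2 : (0 : ℝ) < 2 ^ k := by positivity
      nlinarith
    exact le_of_mul_le_mul_right this hxk

theorem isColexInitial_powersetCard (s : Finset α) (k : ℕ) :
    IsColexInitial s (s.powersetCard k) k :=
  ⟨fun _ hA => mem_powersetCard.1 hA, fun _ _ _ hB hk _ => mem_powersetCard.2 ⟨hB, hk⟩⟩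

/-- Deleting the colex-largest member preserves initial segments, so a shadow can be trimmed to the
rounded size. -/
theorem IsColexInitial.exists_subset_card_eq {s : Finset α} {𝒜 : Finset (Finset α)} {k m : ℕ}
    (h : IsColexInitial s 𝒜 k) (hm : m ≤ #𝒜) :
    ∃ ℬ ⊆ 𝒜, IsColexInitial s ℬ k ∧ #ℬ = m := by
  induction hn : #𝒜 - m generalizing 𝒜 with
  | zero => exact ⟨𝒜, Subset.rfl, h, by omega⟩
  | succ n ih =>
    obtain ⟨A, hA, hmax⟩ := 𝒜.exists_max_image toColex (card_pos.1 (by omega))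
    have hcard := card_erase_of_mem hA
    have hi : IsColexInitial s (𝒜.erase A) k := by
      refine ⟨fun B hB => h.1 B (mem_of_mem_erase hB), fun B hB C hC hk hlt => ?_⟩
      refine mem_erase.2 ⟨?_, h.2 B (mem_of_mem_erase hB) C hC hk hlt⟩
      rintro rfl
      exact absurd hlt (hmax B (mem_of_mem_erase hB)).not_gt
    obtain ⟨ℬ, hℬ, hi, hc⟩ := ih hi (by omega) (by omega)
    exact ⟨ℬ, hℬ.trans (erase_subset _ _), hi, hc⟩

theorem IsColexInitial.shadow {n k : ℕ} {𝒜 : Finset (Finset (Fin n))}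
    (h : IsColexInitial univ 𝒜 (k + 1)) : IsColexInitial univ (∂ 𝒜) k := by
  have h' : IsInitSeg 𝒜 (k + 1) :=
    ⟨fun A hA => (h.1 A hA).2, fun A B hA hB => h.2 A hA B (subset_univ _) hB.2 hB.1⟩
  have hs := h'.shadow
  exact ⟨fun A hA => ⟨subset_univ _, hs.1 hA⟩, fun A hA B _ hk hlt => hs.2 hA ⟨hlt, hk⟩⟩

/-- There are families of `k`-subsets of `Fin d`, one for each `k < d`, each of which lies in the
shadow of the next one and has density just above `2⁻ᵏ`. -/
theorem exists_families {d : ℕ} (hd : 1 ≤ d) : ∃ 𝒜 : ℕ → Finset (Finset (Fin d)), ∀ k < d,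
    (∀ A ∈ 𝒜 k, #A = k) ∧ d.choose k ≤ 2 ^ k * #(𝒜 k) ∧ 2 ^ k * #(𝒜 k) < d.choose k + 2 ^ k ∧
      (k + 1 < d → 𝒜 k ⊆ ∂ (𝒜 (k + 1))) := by
  suffices H : ∀ m < d, ∃ 𝒜 : ℕ → Finset (Finset (Fin d)), ∀ k < d, d - 1 - m ≤ k →
      IsColexInitial univ (𝒜 k) k ∧ d.choose k ≤ 2 ^ k * #(𝒜 k) ∧
        2 ^ k * #(𝒜 k) < d.choose k + 2 ^ k ∧ (k + 1 < d → 𝒜 k ⊆ ∂ (𝒜 (k + 1))) by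
    obtain ⟨𝒜, h⟩ := H (d - 1) (by omega)
    refine ⟨𝒜, fun k hk => ?_⟩
    obtain ⟨h1, h2⟩ := h k hk (by omega)
    exact ⟨fun A hA => (h1.1 A hA).2, h2⟩
  -- The minimal `m` is `a / 2 ^ k` rounded up; the rounding costs less than `2 ^ k`.
  have hround : ∀ a k N : ℕ, a ≤ 2 ^ k * N →
      ∃ m ≤ N, a ≤ 2 ^ k * m ∧ 2 ^ k * m < a + 2 ^ k := by
    intro a k N haN
    have hex : ∃ m, a ≤ 2 ^ k * m := ⟨N, haN⟩
    refine ⟨Nat.find hex, Nat.find_min' hex haN, Nat.find_spec hex, ?_⟩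
    rcases Nat.eq_zero_or_pos (Nat.find hex) with h0 | h0
    · rw [h0]; positivity
    · have := Nat.find_min hex (Nat.sub_lt h0 one_pos)
      obtain ⟨q, hq⟩ := Nat.exists_eq_succ_of_ne_zero h0.ne'
      rw [hq] at this ⊢
      simp only [Nat.succ_sub_one, not_le] at this
      rw [Nat.mul_succ]
      omega
  intro m
  induction m with
  | zero =>
    intro _
    have hc : #((univ : Finset (Fin d)).powersetCard (d - 1)) = d.choose (d - 1) := by simp
    obtain ⟨m, hm, h1, h2⟩ := hround (d.choose (d - 1)) (d - 1) (d.choose (d - 1))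
      (Nat.le_mul_of_pos_left _ (by positivity))
    obtain ⟨ℬ, -, hi, hℬ⟩ :=
      (isColexInitial_powersetCard (univ : Finset (Fin d)) (d - 1)).exists_subset_card_eq
        (hm.trans hc.ge)
    refine ⟨fun _ => ℬ, fun k hk hk' => ?_⟩
    obtain rfl : k = d - 1 := by omega
    exact ⟨hi, hℬ ▸ h1, hℬ ▸ h2, fun h => by omega⟩
  | succ m ih =>
    intro hm
    obtain ⟨𝒜, h⟩ := ih (by omega)
    obtain ⟨k, hk⟩ : ∃ k, k + 1 = d - 1 - m := ⟨d - 2 - m, by omega⟩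
    obtain ⟨h1, h2, h3, -⟩ := h (k + 1) (by omega) (by omega)
    have hne : (𝒜 (k + 1)).Nonempty := by
      rw [nonempty_iff_ne_empty]
      intro h0
      rw [h0, card_empty, mul_zero, Nat.le_zero, Nat.choose_eq_zero_iff] at h2
      omega
    obtain ⟨N, hN, h4, h5⟩ := hround _ _ _ (h1.choose_le_card_shadow hne (by omega) h2)
    obtain ⟨ℬ, hℬ, hi, hc⟩ := h1.shadow.exists_subset_card_eq hN
    refine ⟨Function.update 𝒜 k ℬ, fun j hj hj' => ?_⟩
    rcases eq_or_ne j k with rfl | hjk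
    · rw [Function.update_self, Function.update_of_ne (by omega), hc]
      exact ⟨hi, h4, h5, fun _ => hℬ⟩
    · rw [Function.update_of_ne hjk, Function.update_of_ne (by omega)]
      exact h j hj (by omega)

end Shadow

/-! ### Strategies built from parent maps. -/

section Tree

variable {V : Type*} {G : SimpleGraph V} {r : V} {l : V → ℕ}

/-- The subgraph of `G` formed by the root, the vertices of `S`, and the edges from each vertex of
`S` to its image under the parent map `p`. -/
def parentSubgraph (r : V) (S : Set V) (p : V → V)
    (hp : ∀ v ∈ S, G.Adj v (p v) ∧ (p v ∈ S ∨ p v = r)) : G.Subgraph where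
  verts := insert r S
  Adj u v := (u ∈ S ∧ p u = v) ∨ (v ∈ S ∧ p v = u)
  adj_sub := by
    rintro u v (⟨h, rfl⟩ | ⟨h, rfl⟩)
    · exact (hp u h).1
    · exact (hp v h).1.symm
  edge_vert := by
    rintro u v (⟨h, rfl⟩ | ⟨h, rfl⟩)
    · exact Or.inr h
    · exact (hp v h).2.symm
  symm := ⟨fun _ _ h => h.symm⟩

section

variable {S : Set V} {p : V → V} {hp : ∀ v ∈ S, G.Adj v (p v) ∧ (p v ∈ S ∨ p v = r)}

theorem parentSubgraph_exists_walk (hr : l r = 0) (hl : ∀ v ∈ S, l v = l (p v) + 1) :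
    ∀ (n : ℕ) (v : (parentSubgraph r S p hp).verts), l v = n →
      ∃ w : (parentSubgraph r S p hp).coe.Walk ⟨r, Or.inl rfl⟩ v, w.length = n := by
  intro n
  induction n with
  | zero =>
    rintro ⟨v, rfl | hv⟩ h
    · exact ⟨.nil, rfl⟩
    · have := hl v hv
      simp only at h
      omega
  | succ n ih =>
    rintro ⟨v, rfl | hv⟩ h
    · simp only at h
      omega
    · have := hl v hv
      simp only at h
      obtain ⟨w, hw⟩ := ih ⟨p v, (hp v hv).2.symm⟩ (by simp only; omega)
      exact ⟨w.concat (Or.inr ⟨hv, rfl⟩), (SimpleGraph.Walk.length_concat _ _).trans (congrArg (· + 1) hw)⟩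

theorem parentSubgraph_le_of_walk (hl : ∀ v ∈ S, l v = l (p v) + 1) {u v : V}
    (w : (parentSubgraph r S p hp).spanningCoe.Walk u v) : l v ≤ l u + w.length := by
  induction w with
  | nil => simp
  | cons h w ih =>
    rw [SimpleGraph.Walk.length_cons]
    rcases h with ⟨h, rfl⟩ | ⟨h, rfl⟩
    · have := hl _ h
      omega
    · have := hl _ h
      omega

/-- Following parents gives a walk of length `l v`, and `l` changes by one along each edge, so no
walk is shorter. Thus `IsParent` can be read off from levels. -/
theorem parentSubgraph_dist (hr : l r = 0) (hl : ∀ v ∈ S, l v = l (p v) + 1) {v : V}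
    (hv : v ∈ (parentSubgraph r S p hp).verts) :
    (parentSubgraph r S p hp).spanningCoe.dist r v = l v := by
  obtain ⟨w, hw⟩ := parentSubgraph_exists_walk hr hl _ ⟨v, hv⟩ rfl
  let f : (parentSubgraph r S p hp).coe →g (parentSubgraph r S p hp).spanningCoe :=
    ⟨Subtype.val, fun h => h⟩
  apply le_antisymm
  · have := SimpleGraph.dist_le (w.map f)
    rw [SimpleGraph.Walk.length_map, hw] at this
    exact this
  · have hreach : (parentSubgraph r S p hp).spanningCoe.Reachable r v := ⟨w.map f⟩
    obtain ⟨w', hw'⟩ := hreach.exists_walk_length_eq_dist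
    have := parentSubgraph_le_of_walk hl w'
    omega

theorem parentSubgraph_isTree [Finite V] (hr : l r = 0) (hl : ∀ v ∈ S, l v = l (p v) + 1) :
    (parentSubgraph r S p hp).coe.IsTree := by
  have hconn : (parentSubgraph r S p hp).coe.Connected := by
    rw [SimpleGraph.connected_iff_exists_forall_reachable]
    exact ⟨⟨r, Or.inl rfl⟩, fun v => ⟨(parentSubgraph_exists_walk hr hl _ v rfl).choose⟩⟩
  have hrS : r ∉ S := fun h => by have := hl r h; omega
  rw [SimpleGraph.isTree_iff_connected_and_card]
  refine ⟨hconn, le_antisymm ?_ hconn.card_vert_le_card_edgeSet_add_one⟩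
  have hcard : Nat.card (parentSubgraph r S p hp).verts = Nat.card S + 1 := by
    change (insert r S).ncard = S.ncard + 1
    exact Set.ncard_insert_of_notMem hrS S.toFinite
  rw [hcard]
  -- Every edge joins some `v ∈ S` to `p v`, so there are at most `#S` edges; a connected graph with
  -- `#S + 1` vertices is then a tree.
  refine Nat.add_le_add_right (Nat.card_le_card_of_surjective (fun v : S =>
    (⟨s(⟨v, Or.inr v.2⟩, ⟨p v, (hp v v.2).2.symm⟩), Or.inl ⟨v.2, rfl⟩⟩ :
      (parentSubgraph r S p hp).coe.edgeSet)) ?_) 1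
  rintro ⟨e, he⟩
  induction e with
  | _ u v =>
    obtain ⟨u, hu⟩ := u
    obtain ⟨v, hv⟩ := v
    rcases he with ⟨h, h'⟩ | ⟨h, h'⟩
    · simp only at h h'
      subst h'
      exact ⟨⟨u, h⟩, rfl⟩
    · simp only at h h'
      subst h'
      exact ⟨⟨v, h⟩, Subtype.ext Sym2.eq_swap⟩

end

open scoped Classical in
/-- The strategy on the tree given by a parent map that decreases the level `l` by one, whose
weights are `2⁻ˡ`. -/
noncomputable def levelStrategy [Finite V] (S : Set V) (hS : S.Nonempty) (p : V → V)
    (hp : ∀ v ∈ S, G.Adj v (p v) ∧ (p v ∈ S ∨ p v = r)) (hr : l r = 0)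
    (hl : ∀ v ∈ S, l v = l (p v) + 1) : Strategy G r where
  tree := parentSubgraph r S p hp
  isTree := parentSubgraph_isTree hr hl
  root_mem := Or.inl rfl
  nontrivial := by
    obtain ⟨v, hv⟩ := hS
    refine ⟨r, Or.inl rfl, v, Or.inr hv, ?_⟩
    rintro rfl
    have := hl _ hv
    omega
  weight v := if v ∈ S then (1 / 2 : ℝ) ^ l v else 0
  weight_nonneg v := by positivity
  weight_ne_zero h := by
    obtain ⟨v, hv⟩ := hS
    have := congrFun h v
    simp [hv] at this
  weight_root := by
    have hrS : r ∉ S := fun h => by have := hl r h; omega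
    simp [hrS]
  weight_off v hv := if_neg fun h => hv (Or.inr h)
  weight_parent u v hu h := by
    obtain ⟨hadj, hdist⟩ := h
    rw [parentSubgraph_dist hr hl (SimpleGraph.Subgraph.edge_vert _ hadj.symm),
      parentSubgraph_dist hr hl (SimpleGraph.Subgraph.edge_vert _ hadj)] at hdist
    have hv : v ∈ S := by
      rcases hadj.snd_mem with rfl | h
      · omega
      · exact h
    have hu' : u ∈ S := by
      rcases hadj.fst_mem with rfl | h
      · exact absurd rfl hu
      · exact h
    rw [if_pos hv, if_pos hu', hdist, pow_succ]
    ring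

theorem Feasible.sum_pow_mul_le [Fintype V] [DecidableEq V] {C : Config V} (hC : Feasible G r C)
    (hr : l r = 0) (S : Finset V)
    (h : ∀ v ∈ S, ∃ u, G.Adj v u ∧ (u ∈ S ∨ u = r) ∧ l v = l u + 1) :
    ∑ v ∈ S, (1 / 2 : ℝ) ^ l v * C v ≤ ∑ v ∈ S, (1 / 2 : ℝ) ^ l v := by
  rcases S.eq_empty_or_nonempty with rfl | hS
  · simp
  have h' : ∀ v, ∃ u, v ∈ S → G.Adj v u ∧ (u ∈ S ∨ u = r) ∧ l v = l u + 1 := by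
    intro v
    by_cases hv : v ∈ S
    · obtain ⟨u, hu⟩ := h v hv
      exact ⟨u, fun _ => hu⟩
    · exact ⟨v, fun h => absurd h hv⟩
  choose p hp using h'
  have hrS : r ∉ S := fun h => by have := (hp r h).2.2; omega
  have := hC (levelStrategy (S : Set V) hS p (fun v hv => ⟨(hp v hv).1, (hp v hv).2.1⟩) hr
    (fun v hv => (hp v hv).2.2))
  simp only [Strategy.weightOf, Strategy.treeConfig, levelStrategy, parentSubgraph,
    Finset.mem_coe, ite_mul, zero_mul, ← Finset.sum_filter, Finset.filter_mem_eq_inter,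
    Finset.univ_inter] at this
  refine this.trans_eq (Finset.sum_congr rfl fun v hv => ?_)
  have : v ≠ r := fun h => hrS (h ▸ hv)
  simp [hv, this]

end Tree

/-! ### Averaging strategies over coordinate permutations of the cube. -/

section Cube

open Finset

/-- A vertex of the cube corresponds to the set of coordinates in which it agrees with `r`. -/
def agreeEquiv {d : ℕ} (r : Fin d → Bool) : (Fin d → Bool) ≃ Finset (Fin d) where
  toFun v := {i | v i = r i}
  invFun A i := if i ∈ A then r i else !(r i)
  left_inv v := by
    ext i
    simp only [mem_filter_univ]
    split_ifs with h
    · exact h.symm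
    · cases hv : v i <;> cases hr : r i <;> simp_all
  right_inv A := by
    ext i
    simp

variable {d : ℕ} {r : Fin d → Bool}

theorem hammingDist_add_card_agree (v : Fin d → Bool) :
    hammingDist v r + #(agreeEquiv r v) = d := by
  have := card_filter_add_card_filter_not (s := (univ : Finset (Fin d))) (fun i => v i = r i)
  rw [card_univ, Fintype.card_fin, add_comm] at this
  exact this

theorem hammingDist_symm_agree (A : Finset (Fin d)) :
    hammingDist ((agreeEquiv r).symm A) r = d - #A := by
  have := hammingDist_add_card_agree (r := r) ((agreeEquiv r).symm A)
  rw [Equiv.apply_symm_apply] at this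
  omega

theorem cube_adj_symm_agree {A : Finset (Fin d)} {b : Fin d} (hb : b ∉ A) :
    (cube d).Adj ((agreeEquiv r).symm A) ((agreeEquiv r).symm (insert b A)) := by
  change #_ = 1
  rw [card_eq_one]
  refine ⟨b, ?_⟩
  ext i
  rw [mem_filter_univ, mem_singleton]
  change (if i ∈ A then r i else !(r i)) ≠ (if i ∈ insert b A then r i else !(r i)) ↔ _
  rcases eq_or_ne i b with rfl | hib
  · simp [hb]
  · simp [mem_insert, hib]

theorem symm_agree_univ : (agreeEquiv r).symm univ = r := by
  ext i
  simp [agreeEquiv]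

/-- The inequality of the strategy given by a family of proper subsets, each of which becomes
either another member or the whole set after adding a suitable element. -/
theorem Feasible.sum_two_pow_card_mul_le {C : Config (Fin d → Bool)} (hC : Feasible (cube d) r C)
    (𝒮 : Finset (Finset (Fin d)))
    (h : ∀ A ∈ 𝒮, ∃ b ∉ A, insert b A ∈ 𝒮 ∨ insert b A = univ) :
    ∑ A ∈ 𝒮, 2 ^ #A * C ((agreeEquiv r).symm A) ≤ ∑ A ∈ 𝒮, 2 ^ #A := by
  have key := hC.sum_pow_mul_le (l := fun v => hammingDist v r) (hammingDist_self r)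
    (𝒮.map (agreeEquiv r).symm.toEmbedding) (by
      intro v hv
      obtain ⟨A, hA, rfl⟩ := mem_map.1 hv
      obtain ⟨b, hb, h'⟩ := h A hA
      refine ⟨(agreeEquiv r).symm (insert b A), cube_adj_symm_agree hb, ?_, ?_⟩
      · rcases h' with h' | h'
        · exact Or.inl (mem_map_of_mem _ h')
        · exact Or.inr (by rw [h', symm_agree_univ])
      · have h1 := card_insert_of_notMem hb
        have h2 := card_le_univ (insert b A)
        rw [Fintype.card_fin] at h2
        change hammingDist ((agreeEquiv r).symm A) r = _
        simp only [hammingDist_symm_agree]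
        omega)
  simp only [sum_map, Equiv.coe_toEmbedding, hammingDist_symm_agree] at key
  have hpow : ∀ A : Finset (Fin d), (1 / 2 : ℝ) ^ (d - #A) = 2 ^ #A / 2 ^ d := by
    intro A
    have h2 := card_le_univ A
    rw [Fintype.card_fin] at h2
    rw [eq_div_iff (by positivity)]
    obtain ⟨m, hm⟩ := Nat.exists_eq_add_of_le h2
    rw [show d - #A = m by omega, show (2 : ℝ) ^ d = 2 ^ #A * 2 ^ m from (congrArg _ hm).trans (pow_add _ _ _),
      mul_left_comm, ← mul_pow]
    norm_num
  simp only [hpow, div_mul_eq_mul_div, ← sum_div] at key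
  rw [div_le_div_iff_of_pos_right (by positivity)] at key
  exact_mod_cast key

theorem exists_perm_map_eq {α : Type*} [Fintype α] [DecidableEq α] {A B : Finset α}
    (h : #A = #B) : ∃ τ : Equiv.Perm α, A.map τ.toEmbedding = B := by
  let e : {x // x ∈ A} ≃ {x // x ∈ B} := Finset.equivOfCardEq h
  refine ⟨e.extendSubtype, ?_⟩
  refine eq_of_subset_of_card_le (fun x hx => ?_) (by rw [card_map, h])
  obtain ⟨a, ha, rfl⟩ := mem_map.1 hx
  exact e.extendSubtype_mem a ha

/-- The average of `f` over the images of `A` under all permutations is its average over all sets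
of the size of `A`. -/
theorem choose_mul_sum_perm {α : Type*} [Fintype α] [DecidableEq α] (f : Finset α → ℕ)
    (A : Finset α) :
    (Fintype.card α).choose #A * ∑ σ : Equiv.Perm α, f (A.map σ.toEmbedding)
      = (Fintype.card α).factorial * ∑ B ∈ powersetCard #A univ, f B := by
  -- Double count the pairs of a permutation and a set of size `#A`: the sum over permutations
  -- depends only on that size, and each permutation permutes the sets of that size.
  have h1 : ∀ B ∈ powersetCard #A (univ : Finset α),
      ∑ σ : Equiv.Perm α, f (B.map σ.toEmbedding) = ∑ σ : Equiv.Perm α, f (A.map σ.toEmbedding) := by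
    intro B hB
    obtain ⟨τ, rfl⟩ := exists_perm_map_eq (mem_powersetCard.1 hB).2.symm
    refine Fintype.sum_equiv (Equiv.mulRight τ) _ _ fun σ => ?_
    rw [map_map]
    rfl
  have h2 : ∀ σ : Equiv.Perm α, ∑ B ∈ powersetCard #A univ, f (B.map σ.toEmbedding)
      = ∑ B ∈ powersetCard #A univ, f B := by
    intro σ
    refine sum_equiv σ.finsetCongr (fun B => ?_) fun B _ => ?_
    · simp [mem_powersetCard]
    · rfl
  have h3 := sum_congr rfl h1
  rw [sum_const, card_powersetCard, card_univ, sum_comm, sum_congr rfl fun σ _ => h2 σ, sum_const,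
    card_univ, Fintype.card_perm] at h3
  simpa using h3.symm

theorem sum_erase_root_eq (C : Config (Fin d → Bool)) :
    ∑ v ∈ univ.erase r, C v
      = ∑ k ∈ range d, ∑ A ∈ powersetCard k univ, C ((agreeEquiv r).symm A) := by
  have h1 : ∑ v ∈ univ.erase r, C v
      = ∑ A ∈ (univ : Finset (Finset (Fin d))).erase univ, C ((agreeEquiv r).symm A) := by
    refine sum_equiv (agreeEquiv r) (fun v => ?_) fun v _ => by rw [Equiv.symm_apply_apply]
    have := symm_agree_univ (r := r)
    rw [mem_erase, mem_erase, ne_eq, ne_eq, ← Equiv.eq_symm_apply, this]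
    simp
  rw [h1, ← sum_fiberwise_of_maps_to (g := card) (t := range d)]
  · refine sum_congr rfl fun k hk => sum_congr ?_ fun _ _ => rfl
    ext A
    rw [mem_range] at hk
    simp only [mem_filter, mem_erase, mem_univ, and_true, mem_powersetCard, subset_univ, true_and]
    refine ⟨fun h => h.2, fun h => ⟨?_, h⟩⟩
    rintro rfl
    simp at h
    omega
  · intro A hA
    rw [mem_erase] at hA
    have h2 := card_lt_card (ssubset_univ_iff.2 hA.1)
    simpa using h2

theorem Feasible.sum_lt (hd : 1 ≤ d) {C : Config (Fin d → Bool)} (hC : Feasible (cube d) r C) :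
    ∑ v ∈ univ.erase r, C v < 2 * 2 ^ d := by
  obtain ⟨𝒜, h𝒜⟩ := exists_families hd
  have hdisj : ((range d : Finset ℕ) : Set ℕ).PairwiseDisjoint 𝒜 := by
    intro i hi j hj hij
    rw [Function.onFun, disjoint_left]
    intro A hAi hAj
    exact hij (((h𝒜 i (mem_range.1 hi)).1 A hAi).symm.trans ((h𝒜 j (mem_range.1 hj)).1 A hAj))
  have hup : ∀ A ∈ (range d).biUnion 𝒜,
      ∃ b ∉ A, insert b A ∈ (range d).biUnion 𝒜 ∨ insert b A = univ := by
    intro A hA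
    obtain ⟨k, hk, hA⟩ := mem_biUnion.1 hA
    rw [mem_range] at hk
    obtain ⟨h1, -, -, h4⟩ := h𝒜 k hk
    rcases eq_or_ne (k + 1) d with hkd | hkd
    · obtain ⟨b, hb⟩ : ∃ b, b ∉ A := by
        by_contra! h
        have := h1 A hA
        rw [eq_univ_of_forall h, card_univ, Fintype.card_fin] at this
        omega
      refine ⟨b, hb, Or.inr ?_⟩
      rw [← card_eq_iff_eq_univ, card_insert_of_notMem hb, h1 A hA, hkd, Fintype.card_fin]
    · obtain ⟨b, hb, h⟩ := mem_shadow_iff_insert_mem.1 (h4 (by omega) hA)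
      exact ⟨b, hb, Or.inl (mem_biUnion.2 ⟨k + 1, mem_range.2 (by omega), h⟩)⟩
  have hσ : ∀ σ : Equiv.Perm (Fin d),
      ∑ k ∈ range d, ∑ A ∈ 𝒜 k, 2 ^ k * C ((agreeEquiv r).symm (A.map σ.toEmbedding))
        ≤ ∑ k ∈ range d, 2 ^ k * #(𝒜 k) := by
    intro σ
    have := hC.sum_two_pow_card_mul_le (((range d).biUnion 𝒜).map σ.finsetCongr.toEmbedding) (by
      intro B hB
      obtain ⟨A, hA, rfl⟩ := mem_map.1 hB
      obtain ⟨b, hb, h⟩ := hup A hA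
      refine ⟨σ b, by simpa using hb, ?_⟩
      have e : insert (σ b) (σ.finsetCongr.toEmbedding A)
          = σ.finsetCongr.toEmbedding (insert b A) := by
        simp [map_insert]
      rw [e]
      rcases h with h | h
      · exact Or.inl (mem_map_of_mem _ h)
      · exact Or.inr (by rw [h]; simp))
    simp only [sum_map, Equiv.coe_toEmbedding, Equiv.finsetCongr_apply, card_map] at this
    rw [sum_biUnion hdisj, sum_biUnion hdisj] at this
    refine le_trans (le_of_eq ?_) (this.trans (le_of_eq ?_))
    · refine sum_congr rfl fun k hk => sum_congr rfl fun A hA => ?_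
      rw [(h𝒜 k (mem_range.1 hk)).1 A hA]
    · refine sum_congr rfl fun k hk => ?_
      rw [sum_congr rfl fun A hA => by rw [(h𝒜 k (mem_range.1 hk)).1 A hA], sum_const, smul_eq_mul,
        mul_comm]
  have hsum := sum_le_sum fun σ (_ : σ ∈ (univ : Finset (Equiv.Perm (Fin d)))) => hσ σ
  rw [sum_const, card_univ, Fintype.card_perm, Fintype.card_fin, smul_eq_mul, sum_comm] at hsum
  -- The density bound `d.choose k ≤ 2 ^ k * #(𝒜 k)` makes the averaged coefficient of each vertex
  -- in level `k` at least 1; factors `d.factorial` and `d.choose k` keep everything in `ℕ`.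
  have hlevel : ∀ k ∈ range d, d.factorial * ∑ A ∈ powersetCard k univ, C ((agreeEquiv r).symm A)
      ≤ ∑ σ : Equiv.Perm (Fin d), ∑ A ∈ 𝒜 k,
          2 ^ k * C ((agreeEquiv r).symm (A.map σ.toEmbedding)) := by
    intro k hk
    obtain ⟨h1, h2, -, -⟩ := h𝒜 k (mem_range.1 hk)
    have hch : 0 < d.choose k := Nat.choose_pos (mem_range.1 hk).le
    refine Nat.le_of_mul_le_mul_left ?_ hch
    rw [sum_comm, mul_sum (𝒜 k)]
    have : ∀ A ∈ 𝒜 k, d.choose k * ∑ σ : Equiv.Perm (Fin d),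
        2 ^ k * C ((agreeEquiv r).symm (A.map σ.toEmbedding))
          = 2 ^ k * (d.factorial * ∑ A ∈ powersetCard k univ, C ((agreeEquiv r).symm A)) := by
      intro A hA
      have := choose_mul_sum_perm (fun B => C ((agreeEquiv r).symm B)) A
      rw [Fintype.card_fin, h1 A hA] at this
      rw [← this, ← mul_sum]
      ring
    rw [sum_congr rfl this, sum_const, smul_eq_mul]
    refine le_trans (Nat.mul_le_mul_right _ h2) (le_of_eq ?_)
    ring
  have hle : d.factorial * ∑ v ∈ univ.erase r, C v
      ≤ d.factorial * ∑ k ∈ range d, 2 ^ k * #(𝒜 k) := by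
    rw [sum_erase_root_eq, mul_sum]
    exact (sum_le_sum hlevel).trans hsum
  have hlt : ∑ k ∈ range d, 2 ^ k * #(𝒜 k) < ∑ k ∈ range d, (d.choose k + 2 ^ k) :=
    sum_lt_sum_of_nonempty (nonempty_range_iff.2 (by omega))
      fun k hk => (h𝒜 k (mem_range.1 hk)).2.2.1
  have hchoose := Nat.sum_range_choose d
  rw [sum_range_succ] at hchoose
  have hgeom := Nat.geomSum_eq le_rfl d
  have := Nat.le_of_mul_le_mul_left hle d.factorial_pos
  rw [sum_add_distrib, hgeom] at hlt
  omega

end Cube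

/-! ### The lower bound `2 ^ d` on the pebbling number. -/

section PebblingNumber

open Finset

variable {V : Type*} [DecidableEq V] {G : SimpleGraph V}

theorem exists_reflTransGen_step {u v : V} (huv : G.Adj u v) (m : ℕ) {C : Config V}
    (h : 2 * m ≤ C u) : ∃ D, Relation.ReflTransGen (Step G) C D ∧ m ≤ D v := by
  suffices H : ∀ m C, 2 * m ≤ C u → ∃ D, Relation.ReflTransGen (Step G) C D ∧ C v + m ≤ D v by
    obtain ⟨D, hD, hm⟩ := H m C h
    exact ⟨D, hD, by omega⟩
  intro m
  induction m with
  | zero => exact fun C _ => ⟨C, .refl, le_rfl⟩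
  | succ m ih =>
    intro C hC
    have hvu : v ≠ u := huv.ne'
    obtain ⟨D, hD, hm⟩ := ih (fun x => if x = u then C u - 2 else if x = v then C v + 1 else C x)
      (by simp only [if_true]; omega)
    refine ⟨D, .head ⟨u, v, huv, by omega, rfl⟩ hD, ?_⟩
    simp only [if_neg hvu, if_true] at hm
    omega

theorem solvable_of_two_pow_le {r v : V} (w : G.Walk v r) {C : Config V}
    (h : 2 ^ w.length ≤ C v) : Solvable G r C := by
  induction w generalizing C with
  | nil => exact ⟨C, .refl, by simpa using h⟩
  | cons hadj w ih =>
    rw [SimpleGraph.Walk.length_cons, pow_succ'] at h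
    obtain ⟨D, hD, hv⟩ := exists_reflTransGen_step hadj _ h
    obtain ⟨E, hE, hr⟩ := ih hv
    exact ⟨E, hD.trans hE, hr⟩

variable [Fintype V]

/-- By pigeonhole some vertex holds enough pebbles to reach `r` alone. This excludes the default
value 0 of `sInf` on the empty set. -/
theorem exists_forall_solvable (hG : G.Connected) (r : V) :
    ∃ t, ∀ C : Config V, ∑ v, C v = t → Solvable G r C := by
  choose w _ using fun v => (hG v r).exists_walk_length_eq_dist
  refine ⟨∑ v, 2 ^ (w v).length, fun C hC => ?_⟩
  have : Nonempty V := ⟨r⟩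
  obtain ⟨v, -, hv⟩ := exists_le_of_sum_le univ_nonempty hC.ge
  exact solvable_of_two_pow_le (w v) hv

/-- A weight that at most doubles along edges does not increase under pebbling steps. -/
theorem Step.sum_mul_le {f : V → ℕ} (hf : ∀ u v, G.Adj u v → f v ≤ 2 * f u) {C D : Config V}
    (h : Step G C D) : ∑ v, f v * D v ≤ ∑ v, f v * C v := by
  obtain ⟨u, v, huv, hu, rfl⟩ := h
  have hvu : v ∈ (univ : Finset V).erase u := mem_erase.2 ⟨huv.ne', mem_univ v⟩
  rw [← add_sum_erase _ _ (mem_univ u), ← add_sum_erase _ _ hvu,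
    ← add_sum_erase univ (fun v => f v * C v) (mem_univ u), ← add_sum_erase _ _ hvu]
  have hrest : ∑ x ∈ (univ.erase u).erase v,
      f x * (if x = u then C u - 2 else if x = v then C v + 1 else C x)
        = ∑ x ∈ (univ.erase u).erase v, f x * C x := by
    refine sum_congr rfl fun x hx => ?_
    rw [mem_erase, mem_erase] at hx
    rw [if_neg hx.2.1, if_neg hx.1]
  simp only [hrest, if_true, if_neg huv.ne']
  obtain ⟨c, hc⟩ := Nat.exists_eq_add_of_le hu
  rw [hc, Nat.add_sub_cancel_left]
  have := hf u v huv
  nlinarith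

theorem le_sum_of_solvable {f : V → ℕ} (hf : ∀ u v, G.Adj u v → f v ≤ 2 * f u) {r : V}
    {C : Config V} (h : Solvable G r C) : f r ≤ ∑ v, f v * C v := by
  obtain ⟨D, hD, hr⟩ := h
  have hle : ∑ v, f v * D v ≤ ∑ v, f v * C v := by
    clear hr
    induction hD with
    | refl => exact le_rfl
    | tail _ hs ih => exact (hs.sum_mul_le hf).trans ih
  refine le_trans ?_ hle
  exact (Nat.le_mul_of_pos_right _ hr).trans
    (single_le_sum (f := fun v => f v * D v) (fun _ _ => Nat.zero_le _) (mem_univ r))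

theorem cube_connected (d : ℕ) : (cube d).Connected := by
  rw [SimpleGraph.connected_iff_exists_forall_reachable]
  let r : Fin d → Bool := fun _ => true
  refine ⟨r, fun v => ?_⟩
  suffices H : ∀ A : Finset (Fin d), (cube d).Reachable r ((agreeEquiv r).symm A) by
    simpa using H (agreeEquiv r v)
  intro A
  induction hn : d - #A generalizing A with
  | zero =>
    have hA : A = univ := by
      rw [← card_eq_iff_eq_univ, Fintype.card_fin]
      have := card_le_univ A
      rw [Fintype.card_fin] at this
      omega
    rw [hA, symm_agree_univ]
  | succ n ih =>
    obtain ⟨b, hb⟩ : ∃ b, b ∉ A := by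
      by_contra! h
      rw [eq_univ_of_forall h, card_univ, Fintype.card_fin] at hn
      omega
    have hc := card_insert_of_notMem hb
    exact (ih (insert b A) (by omega)).trans (cube_adj_symm_agree hb).reachable.symm

theorem two_pow_le_pebblingNumber (d : ℕ) (r : Fin d → Bool) :
    2 ^ d ≤ pebblingNumber (cube d) r := by
  have hmem : ∀ C, ∑ v, C v = pebblingNumber (cube d) r → Solvable (cube d) r C :=
    Nat.sInf_mem (exists_forall_solvable (cube_connected d) r)
  let a := (agreeEquiv r).symm ∅
  -- All pebbles are stacked on the antipode of `r`, where the weight `2 ^ (d - hammingDist v r)` is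
  -- 1; at `r` it is `2 ^ d`.
  have hsolv := hmem (Pi.single a (pebblingNumber (cube d) r)) (by simp)
  have := le_sum_of_solvable (f := fun v => 2 ^ (d - hammingDist v r)) (fun u v huv => by
    rw [← pow_succ']
    refine Nat.pow_le_pow_right two_pos ?_
    have h1 : hammingDist u v = 1 := huv
    have h2 := hammingDist_triangle u v r
    omega) hsolv
  simpa [Pi.single_apply, a, hammingDist_symm_agree] using this

end PebblingNumber

end Pebbling

theorem mainTheorem9 (d : ℕ) (hd : 1 ≤ d) (r : Fin d → Bool) :
    Pebbling.strategyBound (Pebbling.cube d) r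
      < 2 * (Pebbling.pebblingNumber (Pebbling.cube d) r : ℕ∞) := by
  have hpi := Pebbling.two_pow_le_pebblingNumber d r
  have hpos : 0 < 2 ^ d := by positivity
  -- A supremum need not preserve a strict inequality, so the bound is first made non-strict by
  -- integrality.
  have hle : Pebbling.strategyBound (Pebbling.cube d) r ≤ ((2 * 2 ^ d - 1 : ℕ) : ℕ∞) := by
    refine iSup_le fun C => ?_
    have := C.2.sum_lt hd
    exact_mod_cast (by omega : ∑ v ∈ Finset.univ.erase r, C.1 v ≤ 2 * 2 ^ d - 1)
  refine hle.trans_lt ?_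
  exact_mod_cast (by omega : 2 * 2 ^ d - 1 < 2 * Pebbling.pebblingNumber (Pebbling.cube d) r)
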